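/- Let $N\ge 1$, let $f$ be a holomorphic function on a domain $V\subset\mathbb C^N$ (a nonempty connected open set), let $B\subset V$ be a closed ball of positive radius, and let $r_n$, $n\ge 1$, be rational functions of degree at most $n$ with poles outside $V$, i.e. $r_n=p_n/q_n$ on $V$ with polynomials $p_n,q_n$ of degree at most $n$ such that $q_n$ has no zeros in $V$. Suppose that $\|f-r_n\|_B^{1/n}\to 0$ as $n\to\infty$, where $\|\cdot\|_B$ is the sup-norm on $B$. Let $\Gamma_f=\{(z,f(z)) : z\in V\}$ be the graph of $f$. Then there is a plurisubharmonic function $v:\mathbb C^{N+1}\to[-\infty,\infty)$, not identically $-\infty$, such that $$\{v=-\infty\}\cap(V\times\mathbb C)=\Gamma_f .$$ Moreover $(\Gamma_f)^*_{\mathbb C^{N+1}}\cap(V\times\mathbb C)=\Gamma_f$, where the pluripolar hull $A^*_{\mathbb C^{N+1}}$ of a set $A\subset\mathbb C^{N+1}$ is the set of all $z\in\mathbb C^{N+1}$ such that $h(z)=-\infty$ for every plurisubharmonic function $h$ on $\mathbb C^{N+1}$ with $h=-\infty$ on $A$. -/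

import Mathlib

open MeasureTheory Filter Topology
open scoped ENNReal

namespace PluripolarHull

/-- The mean `(2π)⁻¹ ∫₀^{2π} g(θ) dθ` of an extended-real function that is bounded above
(integral of the positive part, which is then finite, minus integral of the negative part,
which may be infinite). -/
noncomputable def circleMean (g : ℝ → EReal) : EReal :=
  (((ENNReal.ofReal (2 * Real.pi))⁻¹ *
      ∫⁻ θ in Set.Ioc 0 (2 * Real.pi), (g θ).toENNReal : ℝ≥0∞) : EReal) -
    (((ENNReal.ofReal (2 * Real.pi))⁻¹ *
      ∫⁻ θ in Set.Ioc 0 (2 * Real.pi), (-g θ).toENNReal : ℝ≥0∞) : EReal)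

/-- Plurisubharmonic functions on an open set `D` of a complex normed space: upper semicontinuous
functions `D → [-∞, ∞)`, not identically `-∞` on any connected component of `D`, that satisfy the
sub-mean value inequality on every closed complex disc
`{a + ζ b : |ζ| ≤ 1}` contained in `D`. -/
structure IsPlurisubharmonicOn {E : Type*} [NormedAddCommGroup E] [NormedSpace ℂ E]
    (u : E → EReal) (D : Set E) : Prop where
  upperSemicontinuousOn : UpperSemicontinuousOn u D
  ne_top : ∀ z ∈ D, u z ≠ ⊤
  exists_ne_bot : ∀ z ∈ D, ∃ x ∈ connectedComponentIn D z, u x ≠ ⊥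
  le_circleMean : ∀ a b : E, (∀ ζ : ℂ, ‖ζ‖ ≤ 1 → a + ζ • b ∈ D) →
    u a ≤ circleMean fun θ : ℝ => u (a + Complex.exp (θ * Complex.I) • b)

/-- The pluripolar hull of `A` in `D`: the points `z ∈ D` at which every plurisubharmonic function
on `D` that is `-∞` on `A` takes the value `-∞`. -/
def pluripolarHull {E : Type*} [NormedAddCommGroup E] [NormedSpace ℂ E]
    (A D : Set E) : Set E :=
  {z ∈ D | ∀ h : E → EReal, IsPlurisubharmonicOn h D → (∀ x ∈ A, h x = ⊥) → h z = ⊥}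

/-- The graph of `f` over `V`. -/
def graphOver {E : Type*} (f : E → ℂ) (V : Set E) : Set (E × ℂ) :=
  {x | x.1 ∈ V ∧ x.2 = f x.1}

/-- On `V`, the function `r` is a rational function of degree at most `d` with poles outside `V`:
a quotient of two polynomials of total degree at most `d`, the denominator having no zero
in `V`. -/
def IsRationalOn {N : ℕ} (d : ℕ) (r : EuclideanSpace ℂ (Fin N) → ℂ)
    (V : Set (EuclideanSpace ℂ (Fin N))) : Prop :=
  ∃ p q : MvPolynomial (Fin N) ℂ, p.totalDegree ≤ d ∧ q.totalDegree ≤ d ∧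
    ∀ z ∈ V, MvPolynomial.eval (fun i => z i) q ≠ 0 ∧
      r z = MvPolynomial.eval (fun i => z i) p / MvPolynomial.eval (fun i => z i) q

/-- The sup-norm of `g` on `B` (used for continuous `g` on a nonempty compact `B`). -/
noncomputable def supNormOn {E : Type*} (g : E → ℂ) (B : Set E) : ℝ :=
  ⨆ z : B, ‖g z‖

end PluripolarHull

/-! Choose degrees n_j and approximants p_j/q_j with error at most e^{-n_j 4^j} on the ball,
normalized by q_j(c) = 1. Since q_j is zero-free on the ball, factoring it along complex lines
through c bounds it there; Bernstein–Walsh then controls p_j, so |p_j| and |q_j| are at most L^{n_j}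
everywhere with one continuous L.

The function is v = ∑ 2^{-j} n_j⁻¹ log max(|q_j(z) w - p_j(z)|, e^{-n_j 2^j}). Its terms are at most
2^{-j} log(L(z)(1 + |w|)), so the partial sums, corrected by the tail of this bound, decrease to v
and v is plurisubharmonic.

It remains to see that for z in V, |q_j(z)| ≥ e^{-n_j C} and |q_j f - p_j|(z) ≤ e^{n_j (C - δ 4^j)},
with C and δ > 0 independent of j. This is clear near c and spreads through V by connectedness: the
three circles theorem carries the smallness, zero-freeness the lower bound
(`approximatesNear_of_mem_closure`). On the graph 4^j beats the truncation level 2^j, so all late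
terms equal -1 and v = -∞. Off the graph |q_j w - p_j| is only exponentially small in n_j, so late
terms are at least -2^{-j} times a constant and v is finite. The hull statement follows by testing
with v. -/

namespace PluripolarHull

/-! ### Growth estimates for polynomials and holomorphic functions. -/

/-- Hadamard's three circles theorem, at the point `1`. -/
lemma norm_apply_one_le_of_three_circles {g : ℂ → ℂ} {r R a b : ℝ} (hr : 0 < r) (hr1 : r < 1)
    (hR : 1 < R) (hg : DifferentiableOn ℂ g (Metric.closedBall 0 R))
    (ha : ∀ ζ : ℂ, ‖ζ‖ = r → ‖g ζ‖ ≤ a) (hb : ∀ ζ : ℂ, ‖ζ‖ = R → ‖g ζ‖ ≤ b) :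
    ‖g 1‖ ≤ a ^ (1 - (0 - Real.log r) / (Real.log R - Real.log r)) *
      b ^ ((0 - Real.log r) / (Real.log R - Real.log r)) := by
  have hlr : Real.log r < 0 := Real.log_neg hr hr1
  have hlR : 0 < Real.log R := Real.log_pos hR
  have hmaps : Set.MapsTo Complex.exp
      (Complex.HadamardThreeLines.verticalClosedStrip (Real.log r) (Real.log R))
      (Metric.closedBall 0 R) := by
    intro z hz
    have hz' : z.re ≤ Real.log R := hz.2
    rw [mem_closedBall_zero_iff, Complex.norm_exp]
    calc Real.exp z.re ≤ Real.exp (Real.log R) := Real.exp_le_exp.2 hz'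
      _ = R := Real.exp_log (by linarith)
  have hcl : closure (Complex.HadamardThreeLines.verticalStrip (Real.log r) (Real.log R)) ⊆
      Complex.HadamardThreeLines.verticalClosedStrip (Real.log r) (Real.log R) :=
    closure_minimal (fun z hz => ⟨hz.1.le, hz.2.le⟩)
      (isClosed_Icc.preimage Complex.continuous_re)
  -- The three lines theorem for g ∘ exp, evaluated at 0 = log 1.
  have key := Complex.HadamardThreeLines.norm_le_interp_of_mem_verticalClosedStrip'
    (f := fun z => g (Complex.exp z)) (z := 0) (a := a) (b := b) (hlr.trans hlR)
    ⟨by simpa using hlr.le, by simpa using hlR.le⟩ ?_ ?_ ?_ ?_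
  · simpa using key
  · refine DifferentiableOn.diffContOnCl ?_
    exact hg.comp Complex.differentiable_exp.differentiableOn (hmaps.mono_left hcl)
  · have hK : BddAbove ((fun ζ => ‖g ζ‖) '' Metric.closedBall 0 R) :=
      ((isCompact_closedBall (0 : ℂ) R).image_of_continuousOn
        hg.continuousOn.norm).bddAbove
    refine hK.mono ?_
    rintro _ ⟨z, hz, rfl⟩
    exact ⟨_, hmaps hz, rfl⟩
  · intro z hz
    refine ha _ ?_
    have hz' : z.re = Real.log r := hz
    rw [Complex.norm_exp, hz', Real.exp_log hr]
  · intro z hz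
    refine hb _ ?_
    have hz' : z.re = Real.log R := hz
    rw [Complex.norm_exp, hz', Real.exp_log (by linarith)]

/-- The Bernstein–Walsh inequality for a disc centred at the origin, at the point `1`. -/
lemma norm_eval_one_le_of_forall_norm_le {P : Polynomial ℂ} {n : ℕ} (hP : P.natDegree ≤ n)
    {t M : ℝ} (ht : 1 ≤ t) (hM : ∀ ζ : ℂ, ‖ζ‖ = t⁻¹ → ‖P.eval ζ‖ ≤ M) :
    ‖P.eval 1‖ ≤ M * t ^ n := by
  have ht0 : 0 < t := by linarith
  -- Reversing coefficients exchanges the circles of radius t⁻¹ and t and keeps the value at 1, so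
  -- the maximum principle on the disc of radius t applies.
  have hQ : ∀ ζ : ℂ, ζ ≠ 0 → (P.reflect n).eval ζ = P.eval ζ⁻¹ * ζ ^ n := by
    intro ζ hζ
    let _ := invertibleOfNonzero (inv_ne_zero hζ)
    have := Polynomial.eval₂_reflect_mul_pow (RingHom.id ℂ) ζ⁻¹ n P hP
    rw [invOf_eq_inv, inv_inv] at this
    simp only [Polynomial.eval₂_id] at this
    rw [← this, mul_assoc, ← mul_pow, inv_mul_cancel₀ hζ, one_pow, mul_one]
  have h1 : (P.reflect n).eval 1 = P.eval 1 := by simpa using hQ 1 one_ne_zero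
  rw [← h1]
  refine Complex.norm_le_of_forall_mem_frontier_norm_le (U := Metric.ball 0 t)
    Metric.isBounded_ball (f := fun ζ => (P.reflect n).eval ζ)
    (P.reflect n).differentiable.diffContOnCl ?_ ?_
  · intro z hz
    rw [frontier_ball _ ht0.ne', mem_sphere_zero_iff_norm] at hz
    have hz0 : z ≠ 0 := by
      rintro rfl
      simp at hz
      linarith
    rw [hQ z hz0, norm_mul, norm_pow, hz]
    gcongr
    exact hM _ (by rw [norm_inv, hz])
  · rw [closure_ball _ ht0.ne']
    simpa using ht

/-- Bounds at `1` for a polynomial all of whose zeros have modulus at least `1 / β`. -/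
lemma norm_eval_one_bounds_of_roots {P : Polynomial ℂ} {n : ℕ} (hP : P.natDegree ≤ n)
    {β : ℝ} (hβ : 0 ≤ β) (hroot : ∀ a ∈ P.roots, 1 ≤ ‖a‖ * β) :
    ‖P.eval 1‖ ≤ ‖P.eval 0‖ * (1 + β) ^ n ∧
      (β ≤ 1 → ‖P.eval 0‖ * (1 - β) ^ n ≤ ‖P.eval 1‖) := by
  have heval : ∀ ζ : ℂ, ‖P.eval ζ‖ =
      ‖P.leadingCoeff‖ * (P.roots.map fun a => ‖ζ - a‖).prod := by
    intro ζ
    have h := (IsAlgClosed.splits P).eq_prod_roots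
    conv_lhs => rw [h]
    rw [Polynomial.eval_mul, Polynomial.eval_C, norm_mul, Polynomial.eval_multiset_prod,
      Multiset.map_map]
    congr 1
    refine (map_multiset_prod (normHom : ℂ →*₀ ℝ) _).trans ?_
    simp
  have hcard : P.roots.card ≤ n := (Polynomial.card_roots' P).trans hP
  have hup : ∀ s : Multiset ℂ, (∀ a ∈ s, 1 ≤ ‖a‖ * β) →
      (s.map fun a => ‖1 - a‖).prod ≤ (s.map fun a => ‖0 - a‖).prod * (1 + β) ^ s.card := by
    intro s
    induction s using Multiset.induction_on with
    | empty => simp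
    | cons a s ih =>
      intro hs
      have h1 := ih fun b hb => hs b (Multiset.mem_cons_of_mem hb)
      have h2 := hs a (Multiset.mem_cons_self a s)
      have h3 : ‖1 - a‖ ≤ ‖a‖ * (1 + β) := by
        have := norm_sub_le (1 : ℂ) a
        rw [norm_one] at this
        linarith
      simp only [Multiset.map_cons, Multiset.prod_cons, Multiset.card_cons, zero_sub, norm_neg]
        at h1 ⊢
      calc _ ≤ (‖a‖ * (1 + β)) * ((s.map fun a => ‖a‖).prod * (1 + β) ^ s.card) := by
            gcongr
            exact Multiset.prod_nonneg (by simp +contextual)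
        _ = _ := by ring
  have hlow : β ≤ 1 → ∀ s : Multiset ℂ, (∀ a ∈ s, 1 ≤ ‖a‖ * β) →
      (s.map fun a => ‖0 - a‖).prod * (1 - β) ^ s.card ≤ (s.map fun a => ‖1 - a‖).prod := by
    intro hβ1 s
    have hβ' : 0 ≤ 1 - β := by linarith
    induction s using Multiset.induction_on with
    | empty => simp
    | cons a s ih =>
      intro hs
      have h1 := ih fun b hb => hs b (Multiset.mem_cons_of_mem hb)
      have h2 := hs a (Multiset.mem_cons_self a s)
      have h3 : ‖a‖ * (1 - β) ≤ ‖1 - a‖ := by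
        have := norm_sub_norm_le a (1 : ℂ)
        rw [norm_one, norm_sub_rev] at this
        linarith
      simp only [Multiset.map_cons, Multiset.prod_cons, Multiset.card_cons, zero_sub, norm_neg]
        at h1 ⊢
      calc _ = (‖a‖ * (1 - β)) * ((s.map fun a => ‖a‖).prod * (1 - β) ^ s.card) := by ring
        _ ≤ _ := by
            gcongr
            exact mul_nonneg (Multiset.prod_nonneg (by simp +contextual)) (by positivity)
  have hnn : 0 ≤ (P.roots.map fun a => ‖0 - a‖).prod :=
    Multiset.prod_map_nonneg fun a _ => norm_nonneg _
  rw [heval 1, heval 0]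
  constructor
  · calc _ ≤ ‖P.leadingCoeff‖ *
          ((P.roots.map fun a => ‖0 - a‖).prod * (1 + β) ^ P.roots.card) := by
          gcongr
          exact hup _ hroot
      _ ≤ ‖P.leadingCoeff‖ * ((P.roots.map fun a => ‖0 - a‖).prod * (1 + β) ^ n) := by
          gcongr
          linarith
      _ = _ := by ring
  · intro hβ1
    calc _ = ‖P.leadingCoeff‖ * ((P.roots.map fun a => ‖0 - a‖).prod * (1 - β) ^ n) := by ring
      _ ≤ ‖P.leadingCoeff‖ *
          ((P.roots.map fun a => ‖0 - a‖).prod * (1 - β) ^ P.roots.card) := by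
          gcongr ?_ * (?_ * ?_)
          exact pow_le_pow_of_le_one (by linarith) (by linarith) hcard
      _ ≤ _ := by
          gcongr
          exact hlow hβ1 _ hroot

/-- The restriction of a polynomial to a complex line is a polynomial. -/
lemma exists_polynomial_eval_line {σ : Type*} (p : MvPolynomial σ ℂ) (a b : σ → ℂ) :
    ∃ P : Polynomial ℂ, P.natDegree ≤ p.totalDegree ∧
      ∀ ζ : ℂ, P.eval ζ = MvPolynomial.eval (fun i => a i + ζ * b i) p := by
  refine ⟨MvPolynomial.aeval (fun i => Polynomial.C (a i) + Polynomial.X * Polynomial.C (b i)) p,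
    ?_, fun ζ => ?_⟩
  · have := MvPolynomial.aeval_natDegree_le p le_rfl
      (fun i => Polynomial.C (a i) + Polynomial.X * Polynomial.C (b i)) (n := 1) (fun i => by
        compute_degree)
    simpa using this
  · have h : (Polynomial.evalRingHom ζ).comp (MvPolynomial.aeval (R := ℂ)
        (fun i => Polynomial.C (a i) + Polynomial.X * Polynomial.C (b i))).toRingHom =
        MvPolynomial.eval (fun i => a i + ζ * b i) := by
      ext i
      · simp
      · simp; ring
    exact congrArg (fun φ => φ p) h

variable {N : ℕ}

lemma exists_polynomial_eval_add_smul (p : MvPolynomial (Fin N) ℂ)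
    (a b : EuclideanSpace ℂ (Fin N)) :
    ∃ P : Polynomial ℂ, P.natDegree ≤ p.totalDegree ∧
      ∀ ζ : ℂ, P.eval ζ = MvPolynomial.eval (fun i => (a + ζ • b) i) p := by
  simpa using exists_polynomial_eval_line p a b

/-- The Bernstein–Walsh inequality for a ball. -/
lemma norm_eval_le_of_forall_mem_closedBall {p : MvPolynomial (Fin N) ℂ} {n : ℕ}
    (hp : p.totalDegree ≤ n) {c : EuclideanSpace ℂ (Fin N)} {ρ M : ℝ} (hρ : 0 < ρ)
    (hM : ∀ x ∈ Metric.closedBall c ρ, ‖MvPolynomial.eval (fun i => x i) p‖ ≤ M)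
    (x : EuclideanSpace ℂ (Fin N)) :
    ‖MvPolynomial.eval (fun i => x i) p‖ ≤ M * (1 + ‖x - c‖ / ρ) ^ n := by
  obtain ⟨P, hPd, hP⟩ := exists_polynomial_eval_add_smul p c (x - c)
  have hnn : 0 ≤ ‖x - c‖ / ρ := by positivity
  -- Adding 1 to the ratio ensures t ≥ 1 even for x inside the ball, at the cost of a weaker bound.
  have := norm_eval_one_le_of_forall_norm_le (hPd.trans hp) (t := 1 + ‖x - c‖ / ρ) (M := M)
    (by linarith) fun ζ hζ => by
      rw [hP]
      apply hM
      rw [mem_closedBall_iff_norm, add_sub_cancel_left, norm_smul, hζ, inv_mul_le_iff₀ (by positivity)]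
      have : ‖x - c‖ / ρ * ρ = ‖x - c‖ := by field_simp
      nlinarith
  simpa [hP] using this

/-- Bounds for a polynomial without zeros in a ball. -/
lemma norm_eval_bounds_of_ne_zero {q : MvPolynomial (Fin N) ℂ} {n : ℕ}
    (hq : q.totalDegree ≤ n) {c : EuclideanSpace ℂ (Fin N)} {ρ : ℝ} (hρ : 0 < ρ)
    (h0 : ∀ x ∈ Metric.ball c ρ, MvPolynomial.eval (fun i => x i) q ≠ 0)
    (x : EuclideanSpace ℂ (Fin N)) :
    ‖MvPolynomial.eval (fun i => x i) q‖ ≤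
        ‖MvPolynomial.eval (fun i => c i) q‖ * (1 + ‖x - c‖ / ρ) ^ n ∧
      (‖x - c‖ ≤ ρ → ‖MvPolynomial.eval (fun i => c i) q‖ * (1 - ‖x - c‖ / ρ) ^ n ≤
        ‖MvPolynomial.eval (fun i => x i) q‖) := by
  obtain ⟨P, hPd, hP⟩ := exists_polynomial_eval_add_smul q c (x - c)
  have := norm_eval_one_bounds_of_roots (hPd.trans hq) (β := ‖x - c‖ / ρ) (by positivity)
    fun a ha => by
      by_contra! hlt
      refine h0 (c + a • (x - c)) ?_ ?_
      · rw [mem_ball_iff_norm, add_sub_cancel_left, norm_smul]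
        rwa [← mul_div_assoc, div_lt_one hρ] at hlt
      · rw [← hP]
        exact (Polynomial.mem_roots'.1 ha).2
  rw [div_le_one hρ] at this
  simpa [hP] using this

/-! ### Sub-mean value inequalities. -/

lemma toENNReal_add_toENNReal_sub {B : ℝ} (hB : 0 ≤ B) {x : EReal} (hx : x ≤ B) :
    x.toENNReal + ((B : EReal) - x).toENNReal = ENNReal.ofReal B + (-x).toENNReal := by
  induction x with
  | bot => simp
  | top => simp at hx
  | coe x =>
    have hx' : x ≤ B := by exact_mod_cast hx
    rw [← EReal.coe_sub, ← EReal.coe_neg]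
    simp only [EReal.real_coe_toENNReal]
    rcases le_total 0 x with h | h
    · rw [ENNReal.ofReal_of_nonpos (p := -x) (by linarith), add_zero,
        ← ENNReal.ofReal_add h (by linarith)]
      congr 1
      ring
    · rw [ENNReal.ofReal_of_nonpos h, zero_add, ← ENNReal.ofReal_add hB (by linarith)]
      congr 1

/-- If `g` is the infimum of a decreasing sequence of continuous functions whose means are all at
least `x`, then the mean of `g` is at least `x`. -/
lemma le_circleMean_of_antitone {g : ℝ → EReal} {S : ℕ → ℝ → ℝ} (hS : ∀ J, Continuous (S J))
    (hanti : ∀ θ, Antitone fun J => S J θ) (hg : ∀ θ, g θ = ⨅ J, (S J θ : EReal))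
    {B : ℝ} (hB : ∀ J θ, S J θ ≤ B) {x : EReal}
    (hx : ∀ J, x ≤ (((2 * Real.pi)⁻¹ * ∫ θ in (0)..(2 * Real.pi), S J θ : ℝ) : EReal)) :
    x ≤ circleMean g := by
  have hpi : 0 < 2 * Real.pi := by positivity
  induction x with
  | bot => simp
  | top => exact absurd (top_le_iff.1 (hx 0)) (EReal.coe_ne_top _)
  | coe y =>
  obtain ⟨B', hB', hB0, hBy⟩ : ∃ B' : ℝ, (∀ J θ, S J θ ≤ B') ∧ 0 ≤ B' ∧ y ≤ B' :=
    ⟨max B (max 0 y), fun J θ => (hB J θ).trans (le_max_left _ _), by simp, by simp⟩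
  have hgB : ∀ θ, g θ ≤ B' := fun θ => by
    rw [hg]
    exact (iInf_le _ 0).trans (by exact_mod_cast hB' 0 θ)
  have hgm : Measurable g := by
    have : g = fun θ => ⨅ J, (S J θ : EReal) := funext hg
    rw [this]
    exact Measurable.iInf fun J => (hS J).measurable.coe_real_ereal
  have htend : ∀ θ, Tendsto (fun J => ENNReal.ofReal (B' - S J θ)) atTop
      (𝓝 ((B' : EReal) - g θ).toENNReal) := by
    intro θ
    have h1 : Tendsto (fun J => (S J θ : EReal)) atTop (𝓝 (g θ)) := by
      rw [hg]
      exact tendsto_atTop_iInf fun i j hij => by exact_mod_cast hanti θ hij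
    have h2 : Tendsto (fun J => (B' : EReal) + -(S J θ : EReal)) atTop (𝓝 ((B' : EReal) + -g θ)) :=
      (EReal.continuousAt_add (p := ((B' : EReal), -g θ)) (by simp) (by simp)).tendsto.comp
        (tendsto_const_nhds.prodMk_nhds ((continuous_neg.tendsto _).comp h1))
    exact (EReal.continuous_toENNReal.tendsto _).comp h2
  -- Fatou's lemma for the nonnegative functions B' - S_J.
  have hW : ∫⁻ θ in Set.Ioc 0 (2 * Real.pi), ((B' : EReal) - g θ).toENNReal ≤
      ENNReal.ofReal (2 * Real.pi * (B' - y)) := by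
    calc _ = ∫⁻ θ in Set.Ioc 0 (2 * Real.pi),
          liminf (fun J => ENNReal.ofReal (B' - S J θ)) atTop :=
          lintegral_congr fun θ => (htend θ).liminf_eq.symm
      _ ≤ liminf (fun J => ∫⁻ θ in Set.Ioc 0 (2 * Real.pi), ENNReal.ofReal (B' - S J θ)) atTop :=
          lintegral_liminf_le fun J => (by fun_prop : Measurable fun θ => B' - S J θ).ennreal_ofReal
      _ ≤ liminf (fun _ : ℕ => ENNReal.ofReal (2 * Real.pi * (B' - y))) atTop := by
          refine liminf_le_liminf (Eventually.of_forall fun J => ?_)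
          have hint : IntervalIntegrable (S J) volume 0 (2 * Real.pi) :=
            (hS J).intervalIntegrable _ _
          have hc : IntervalIntegrable (fun θ => B' - S J θ) volume 0 (2 * Real.pi) :=
            (continuous_const.sub (hS J)).intervalIntegrable _ _
          rw [← ofReal_integral_eq_lintegral_ofReal
            ((intervalIntegrable_iff_integrableOn_Ioc_of_le hpi.le).1 hc)
            (Eventually.of_forall fun θ => sub_nonneg.2 (hB' J θ)),
            ← intervalIntegral.integral_of_le hpi.le]
          apply ENNReal.ofReal_le_ofReal
          rw [intervalIntegral.integral_sub (by simp) hint]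
          have hy : y ≤ (2 * Real.pi)⁻¹ * ∫ θ in (0)..(2 * Real.pi), S J θ := by
            exact_mod_cast hx J
          rw [inv_mul_eq_div, le_div_iff₀ hpi] at hy
          simp only [intervalIntegral.integral_const, sub_zero, smul_eq_mul]
          linarith
      _ = _ := by simp
  have hP : ∫⁻ θ in Set.Ioc 0 (2 * Real.pi), (g θ).toENNReal ≤
      ENNReal.ofReal B' * ENNReal.ofReal (2 * Real.pi) := by
    calc _ ≤ ∫⁻ θ in Set.Ioc 0 (2 * Real.pi), ENNReal.ofReal B' :=
          lintegral_mono fun θ => EReal.toENNReal_le_toENNReal (hgB θ)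
      _ = _ := by simp
  -- The integrated form of g⁺ + (B' - g) = B' + g⁻; it shows that g⁻ has finite integral and
  -- converts the bound on B' - g into one on the mean.
  have hsum : (∫⁻ θ in Set.Ioc 0 (2 * Real.pi), (g θ).toENNReal) +
      ∫⁻ θ in Set.Ioc 0 (2 * Real.pi), ((B' : EReal) - g θ).toENNReal =
      ENNReal.ofReal B' * ENNReal.ofReal (2 * Real.pi) +
        ∫⁻ θ in Set.Ioc 0 (2 * Real.pi), (-g θ).toENNReal := by
    rw [← lintegral_add_left hgm.ereal_toENNReal]
    rw [lintegral_congr fun θ => toENNReal_add_toENNReal_sub hB0 (hgB θ),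
      lintegral_add_left measurable_const]
    simp
  unfold circleMean
  generalize (∫⁻ θ in Set.Ioc 0 (2 * Real.pi), (g θ).toENNReal) = P at *
  generalize (∫⁻ θ in Set.Ioc 0 (2 * Real.pi), ((B' : EReal) - g θ).toENNReal) = W at *
  generalize (∫⁻ θ in Set.Ioc 0 (2 * Real.pi), (-g θ).toENNReal) = M at *
  have hPt : P ≠ ⊤ := ne_top_of_le_ne_top (by finiteness) hP
  have hWt : W ≠ ⊤ := ne_top_of_le_ne_top (by finiteness) hW
  have hMt : M ≠ ⊤ := by
    intro h
    rw [h, add_top] at hsum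
    exact (ENNReal.add_ne_top.2 ⟨hPt, hWt⟩) hsum
  have hW' := ENNReal.toReal_mono (by finiteness) hW
  have hsum' := congrArg ENNReal.toReal hsum
  rw [ENNReal.toReal_add hPt hWt, ENNReal.toReal_add (by finiteness) hMt, ENNReal.toReal_mul,
    ENNReal.toReal_ofReal hB0, ENNReal.toReal_ofReal hpi.le] at hsum'
  rw [ENNReal.toReal_ofReal (mul_nonneg hpi.le (sub_nonneg.2 hBy))] at hW'
  have hconv : ∀ Q : ℝ≥0∞, Q ≠ ⊤ → (((ENNReal.ofReal (2 * Real.pi))⁻¹ * Q : ℝ≥0∞) : EReal) =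
      (((2 * Real.pi)⁻¹ * Q.toReal : ℝ) : EReal) := by
    intro Q hQ
    rw [← ENNReal.ofReal_inv_of_pos hpi]
    conv_lhs => rw [← ENNReal.ofReal_toReal hQ]
    rw [← ENNReal.ofReal_mul (by positivity), EReal.coe_ennreal_ofReal,
      max_eq_left (by positivity)]
  rw [hconv P hPt, hconv M hMt, ← EReal.coe_sub, EReal.coe_le_coe_iff, ← mul_sub,
    inv_mul_eq_div, le_div_iff₀ hpi]
  linarith

/-- The sub-mean value property of `log (max |P| κ)` for a polynomial `P`. -/
lemma log_max_le_integral_log_max (P : Polynomial ℂ) {κ : ℝ} (hκ : 0 < κ) :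
    Real.log (max ‖P.eval 0‖ κ) ≤ (2 * Real.pi)⁻¹ * ∫ θ in (0)..(2 * Real.pi),
      Real.log (max ‖P.eval (Complex.exp (θ * Complex.I))‖ κ) := by
  have hpi : 0 < 2 * Real.pi := by positivity
  have hcont : Continuous fun θ : ℝ =>
      Real.log (max ‖P.eval (Complex.exp (θ * Complex.I))‖ κ) := by
    refine Continuous.log ?_ fun θ => (lt_max_of_lt_right hκ).ne'
    exact ((P.continuous.comp (by fun_prop)).norm).max continuous_const
  rcases le_or_gt ‖P.eval 0‖ κ with h | h
  · rw [max_eq_right h, inv_mul_eq_div, le_div_iff₀ hpi]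
    have : ∫ θ in (0)..(2 * Real.pi), Real.log κ ≤ ∫ θ in (0)..(2 * Real.pi),
        Real.log (max ‖P.eval (Complex.exp (θ * Complex.I))‖ κ) := by
      refine intervalIntegral.integral_mono_on hpi.le (by simp)
        (hcont.intervalIntegrable _ _) fun θ _ => ?_
      exact Real.log_le_log hκ (le_max_right _ _)
    simp only [intervalIntegral.integral_const, sub_zero, smul_eq_mul] at this
    linarith
  · have h0 : P.eval 0 ≠ 0 := norm_pos_iff.1 (hκ.trans h)
    have hP : P ≠ 0 := by
      rintro rfl
      simp at h0
    rw [max_eq_left h.le]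
    -- Jensen's inequality: the constant coefficient is at most the Mahler measure.
    have h1 := P.norm_coeff_le_choose_mul_mahlerMeasure 0
    rw [Polynomial.coeff_zero_eq_eval_zero, Nat.choose_zero_right, Nat.cast_one, one_mul,
      Polynomial.mahlerMeasure_def_of_ne_zero hP] at h1
    have h2 := Real.log_le_log (norm_pos_iff.2 h0) h1
    rw [Real.log_exp] at h2
    refine h2.trans ?_
    gcongr
    refine intervalIntegral.integral_mono_ae_restrict (by positivity)
      P.intervalIntegrable_mahlerMeasure (hcont.intervalIntegrable _ _) ?_
    rw [EventuallyLE, eventually_iff_exists_mem]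
    -- Zeros on the circle are excluded because `Real.log 0 = 0` may exceed log κ there; they are
    -- finitely many.
    refine ⟨{x : ℝ | P.eval (circleMap 0 1 x) ≠ 0}, ?_, ?_⟩
    · rw [mem_ae_iff, Set.compl_def, Measure.restrict_apply' (by simp)]
      apply (Set.Finite.of_sdiff _ <| Set.finite_singleton (2 * Real.pi)).measure_zero
      simp only [ne_eq, Set.mem_ofPred_eq, Decidable.not_not, Set.inter_sdiff_assoc,
        Set.Icc_sdiff_right]
      rw [Set.ofPred_inter_eq_sep]
      apply Set.Finite.of_finite_image (f := circleMap 0 1)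
        ((Multiset.finite_toSet P.roots).subset _)
        <| fun _ h _ k l ↦ injOn_circleMap_of_abs_sub_le' one_ne_zero (by linarith) h.1 k.1 l
      simp [hP]
    · intro θ hθ
      have : circleMap 0 1 θ = Complex.exp (θ * Complex.I) := by simp [circleMap]
      rw [← this]
      exact Real.log_le_log (norm_pos_iff.2 hθ) (le_max_left _ _)

/-! ### Sums of functions with geometrically decaying upper bounds. -/

variable {E : Type*}

/-- The sum `∑ T j`, where `T j ≤ 2⁻ʲ G`, as a decreasing limit. -/
noncomputable def dominatedSum (T : ℕ → E → ℝ) (G : E → ℝ) (x : E) : EReal :=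
  ⨅ J : ℕ, ((∑ j ∈ Finset.range J, T j x + 2 * (1 / 2 : ℝ) ^ J * G x : ℝ) : EReal)

/-- The correction is the tail ∑_{j ≥ J} 2⁻ʲ A; each step replaces one summand of it by the smaller
t_J. -/
lemma antitone_sum_range_add {t : ℕ → ℝ} {A : ℝ} (ht : ∀ j, t j ≤ (1 / 2 : ℝ) ^ j * A) :
    Antitone fun J : ℕ => ∑ j ∈ Finset.range J, t j + 2 * (1 / 2 : ℝ) ^ J * A := by
  refine antitone_nat_of_succ_le fun J => ?_
  rw [Finset.sum_range_succ, pow_succ]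
  linarith [ht J]

/-- Both corrections tend to 0. On a circle this allows G to be replaced by a constant, so no
sub-mean value property of G is needed. -/
lemma dominatedSum_eq_of_le {T : ℕ → E → ℝ} {G : E → ℝ} {x : E} {A : ℝ}
    (hT : ∀ j, T j x ≤ (1 / 2 : ℝ) ^ j * G x) (hA : G x ≤ A) :
    dominatedSum T G x =
      ⨅ J : ℕ, ((∑ j ∈ Finset.range J, T j x + 2 * (1 / 2 : ℝ) ^ J * A : ℝ) : EReal) := by
  refine le_antisymm (iInf_mono fun J => ?_) (le_iInf fun J => ?_)
  · rw [EReal.coe_le_coe_iff]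
    gcongr
  · have hlim : Tendsto (fun K : ℕ => (((∑ j ∈ Finset.range J, T j x +
        2 * (1 / 2 : ℝ) ^ J * G x) + (1 / 2 : ℝ) ^ K * (2 * (A - G x)) : ℝ) : EReal)) atTop
        (𝓝 ((∑ j ∈ Finset.range J, T j x + 2 * (1 / 2 : ℝ) ^ J * G x : ℝ) : EReal)) := by
      rw [EReal.tendsto_coe]
      have := (tendsto_pow_atTop_nhds_zero_of_lt_one (r := (1 / 2 : ℝ)) (by norm_num)
        (by norm_num)).mul_const (2 * (A - G x))
      simpa using this.const_add (∑ j ∈ Finset.range J, T j x + 2 * (1 / 2 : ℝ) ^ J * G x)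
    refine ge_of_tendsto hlim ((eventually_ge_atTop J).mono fun K hK => (iInf_le _ K).trans ?_)
    rw [EReal.coe_le_coe_iff]
    have := antitone_sum_range_add hT hK
    simp only at this
    linarith

lemma isPlurisubharmonicOn_dominatedSum [NormedAddCommGroup E] [NormedSpace ℂ E] {T : ℕ → E → ℝ} {G : E → ℝ}
    (hTc : ∀ j, Continuous (T j)) (hGc : Continuous G)
    (hTG : ∀ j x, T j x ≤ (1 / 2 : ℝ) ^ j * G x)
    (hmean : ∀ j a b, T j a ≤ (2 * Real.pi)⁻¹ * ∫ θ in (0)..(2 * Real.pi),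
      T j (a + Complex.exp ((θ : ℝ) * Complex.I) • b))
    (hbot : ∃ x, dominatedSum T G x ≠ ⊥) :
    IsPlurisubharmonicOn (dominatedSum T G) Set.univ where
  upperSemicontinuousOn := by
    refine upperSemicontinuousOn_iInf fun J => ?_
    exact (continuous_coe_real_ereal.comp (by fun_prop)).upperSemicontinuous.upperSemicontinuousOn _
  ne_top z _ := ne_top_of_le_ne_top (EReal.coe_ne_top _) (iInf_le _ 0)
  exists_ne_bot z _ := by
    obtain ⟨x, hx⟩ := hbot
    exact ⟨x, by simp [isPreconnected_univ.connectedComponentIn (Set.mem_univ z)], hx⟩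
  le_circleMean a b _ := by
    have hcirc : Continuous fun θ : ℝ => a + Complex.exp ((θ : ℝ) * Complex.I) • b := by fun_prop
    obtain ⟨A, hA, hAa⟩ : ∃ A : ℝ,
        (∀ θ : ℝ, G (a + Complex.exp ((θ : ℝ) * Complex.I) • b) ≤ A) ∧ G a ≤ A := by
      have hK : IsCompact ((fun ζ : ℂ => G (a + ζ • b)) '' Metric.closedBall 0 1) :=
        (isCompact_closedBall (0 : ℂ) 1).image (by fun_prop)
      obtain ⟨A, hA⟩ := hK.bddAbove
      refine ⟨A, fun θ => hA ⟨_, ?_, rfl⟩, hA ⟨0, by simp, by simp⟩⟩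
      simp [Complex.norm_exp]
    refine le_circleMean_of_antitone (S := fun J θ =>
      ∑ j ∈ Finset.range J, T j (a + Complex.exp ((θ : ℝ) * Complex.I) • b) +
        2 * (1 / 2 : ℝ) ^ J * A) (B := 2 * A) (fun J => ?_) (fun θ => ?_) (fun θ => ?_)
        (fun J θ => ?_) fun J => ?_
    · fun_prop
    · exact antitone_sum_range_add fun j => (hTG j _).trans (by gcongr; exact hA θ)
    · exact dominatedSum_eq_of_le (fun j => hTG j _) (hA θ)
    · have := antitone_sum_range_add (t := fun j => T j (a + Complex.exp ((θ : ℝ) * Complex.I) • b))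
        (A := A) (fun j => (hTG j _).trans (by gcongr; exact hA θ)) (Nat.zero_le J)
      simpa using this
    · rw [dominatedSum_eq_of_le (fun j => hTG j a) hAa]
      refine (iInf_le _ J).trans ?_
      rw [EReal.coe_le_coe_iff]
      rw [intervalIntegral.integral_add
        ((by fun_prop : Continuous fun θ : ℝ => ∑ j ∈ Finset.range J,
          T j (a + Complex.exp ((θ : ℝ) * Complex.I) • b)).intervalIntegrable _ _) (by simp),
        intervalIntegral.integral_finsetSum
          (f := fun j (θ : ℝ) => T j (a + Complex.exp ((θ : ℝ) * Complex.I) • b)) fun j _ =>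
          ((hTc j).comp hcirc).intervalIntegrable _ _, mul_add, Finset.mul_sum]
      refine add_le_add (Finset.sum_le_sum fun j _ => hmean j a b) (le_of_eq ?_)
      simp only [intervalIntegral.integral_const, sub_zero, smul_eq_mul]
      field_simp

/-- A dominated sum is finite where the negative parts are eventually summable. -/
lemma dominatedSum_ne_bot {T : ℕ → E → ℝ} {G : E → ℝ} {x : E} {C : ℝ} {J₀ : ℕ} (hG : 0 ≤ G x)
    (hC : ∀ j, J₀ ≤ j → -((1 / 2 : ℝ) ^ j * C) ≤ T j x) : dominatedSum T G x ≠ ⊥ := by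
  obtain ⟨D, hD, hD0⟩ : ∃ D : ℝ, (∀ j, -((1 / 2 : ℝ) ^ j * D) ≤ T j x) ∧ 0 ≤ D := by
    -- The finitely many early terms are real numbers, so a larger constant D covers them too.
    obtain ⟨D, hD⟩ := ((Finset.range J₀).image fun j => -(2 : ℝ) ^ j * T j x).bddAbove
    refine ⟨max (max C D) 0, fun j => ?_, by simp⟩
    rcases le_or_gt J₀ j with hj | hj
    · refine le_trans ?_ (hC j hj)
      gcongr
      simp
    · have h1 : -(2 : ℝ) ^ j * T j x ≤ D := hD (by
        simp only [Finset.coe_image, Finset.coe_range]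
        exact ⟨j, hj, rfl⟩)
      have h2 : D ≤ max (max C D) 0 := by simp
      have h3 : (1 / 2 : ℝ) ^ j * (-(2 : ℝ) ^ j * T j x) = -T j x := by
        rw [← mul_assoc, mul_neg, ← mul_pow]
        norm_num
      have h4 : (1 / 2 : ℝ) ^ j * (-(2 : ℝ) ^ j * T j x) ≤ (1 / 2 : ℝ) ^ j * max (max C D) 0 := by
        gcongr
        exact h1.trans h2
      linarith
  have hge : ((-(2 * D) : ℝ) : EReal) ≤ dominatedSum T G x := by
    refine le_iInf fun J => ?_
    rw [EReal.coe_le_coe_iff]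
    have h1 : ∑ j ∈ Finset.range J, -((1 / 2 : ℝ) ^ j * D) ≤ ∑ j ∈ Finset.range J, T j x :=
      Finset.sum_le_sum fun j _ => hD j
    have h2 : ∑ j ∈ Finset.range J, -((1 / 2 : ℝ) ^ j * D) = -(2 * D) + 2 * (1 / 2 : ℝ) ^ J * D := by
      rw [Finset.sum_neg_distrib, ← Finset.sum_mul, geom_sum_eq (by norm_num)]
      ring
    have h3 : 0 ≤ 2 * (1 / 2 : ℝ) ^ J * D := by positivity
    have h4 : 0 ≤ 2 * (1 / 2 : ℝ) ^ J * G x := by positivity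
    linarith
  intro h
  rw [h, le_bot_iff] at hge
  exact EReal.coe_ne_bot _ hge

/-- A dominated sum is `-∞` where the terms are eventually bounded above by `-1`. -/
lemma dominatedSum_eq_bot {T : ℕ → E → ℝ} {G : E → ℝ} {x : E} {J₀ : ℕ}
    (h : ∀ j, J₀ ≤ j → T j x ≤ -1) : dominatedSum T G x = ⊥ := by
  have hsum : ∀ K : ℕ, ∑ j ∈ Finset.range (J₀ + K), T j x ≤
      ∑ j ∈ Finset.range J₀, T j x - K := by
    intro K
    rw [Finset.sum_range_add]
    have : ∑ k ∈ Finset.range K, T (J₀ + k) x ≤ ∑ k ∈ Finset.range K, (-1 : ℝ) :=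
      Finset.sum_le_sum fun k _ => h _ (by omega)
    simp at this
    linarith
  rw [EReal.eq_bot_iff_forall_lt]
  intro y
  obtain ⟨K, hK⟩ := exists_nat_gt (∑ j ∈ Finset.range J₀, T j x + 2 * |G x| - y)
  refine (iInf_le _ (J₀ + K)).trans_lt ?_
  rw [EReal.coe_lt_coe_iff]
  have h1 : (1 / 2 : ℝ) ^ (J₀ + K) * G x ≤ |G x| := by
    calc _ ≤ (1 / 2 : ℝ) ^ (J₀ + K) * |G x| := by
          gcongr
          exact le_abs_self _
      _ ≤ _ := mul_le_of_le_one_left (abs_nonneg _) (pow_le_one₀ (by norm_num) (by norm_num))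
  linarith [hsum K]

/-! ### Propagation of the approximation from the ball to V. -/

/-- Near `z`, the denominators `q j` are not too small and the `q j * f - p j` are small. -/
def ApproximatesNear (f : EuclideanSpace ℂ (Fin N) → ℂ) (p q : ℕ → MvPolynomial (Fin N) ℂ)
    (n : ℕ → ℕ) (m : ℕ → ℝ) (z : EuclideanSpace ℂ (Fin N)) : Prop :=
  ∃ s > 0, ∃ C δ : ℝ, 0 < δ ∧ ∀ j, ∀ x ∈ Metric.ball z s,
    Real.exp (-(n j * C)) ≤ ‖MvPolynomial.eval (fun i => x i) (q j)‖ ∧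
    ‖MvPolynomial.eval (fun i => x i) (q j) * f x - MvPolynomial.eval (fun i => x i) (p j)‖ ≤
      Real.exp (n j * (C - δ * m j))

lemma isOpen_setOf_approximatesNear (f : EuclideanSpace ℂ (Fin N) → ℂ)
    (p q : ℕ → MvPolynomial (Fin N) ℂ) (n : ℕ → ℕ) (m : ℕ → ℝ) :
    IsOpen {z | ApproximatesNear f p q n m z} := by
  rw [Metric.isOpen_iff]
  rintro z ⟨s, hs, C, δ, hδ, h⟩
  refine ⟨s, hs, fun y hy => ?_⟩
  obtain ⟨ε, hε, hsub⟩ := Metric.isOpen_iff.1 Metric.isOpen_ball y hy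
  exact ⟨ε, hε, C, δ, hδ, fun j x hx => h j x (hsub hx)⟩

section

variable {V : Set (EuclideanSpace ℂ (Fin N))} {f : EuclideanSpace ℂ (Fin N) → ℂ}
  {p q : ℕ → MvPolynomial (Fin N) ℂ} {n : ℕ → ℕ} {m : ℕ → ℝ}

/-- Take a good point y near z and join it to x by a complex line. On a small circle about y the
function q_j f - p_j is tiny, on a large one at most exponential in n_j, and three circles
interpolates at x. The denominator loses at most a factor 3^{n_j}, having no zeros in a larger ball
about y. -/
lemma approximatesNear_of_mem_closure {L : EuclideanSpace ℂ (Fin N) → ℝ} (hVo : IsOpen V)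
    (hf : DifferentiableOn ℂ f V) (hL : Continuous L) (hn : ∀ j, 1 ≤ n j)
    (hq : ∀ j, (q j).totalDegree ≤ n j)
    (hq0 : ∀ j, ∀ z ∈ V, MvPolynomial.eval (fun i => z i) (q j) ≠ 0)
    (hpL : ∀ j x, ‖MvPolynomial.eval (fun i => x i) (p j)‖ ≤ L x ^ n j)
    (hqL : ∀ j x, ‖MvPolynomial.eval (fun i => x i) (q j)‖ ≤ L x ^ n j) (hL0 : ∀ x, 0 ≤ L x)
    {z : EuclideanSpace ℂ (Fin N)} (hzV : z ∈ V)
    (hz : z ∈ closure {z | ApproximatesNear f p q n m z}) : ApproximatesNear f p q n m z := by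
  obtain ⟨s, M, hs, hM1, hsV, hfM, hLM⟩ : ∃ s M : ℝ, 0 < s ∧ 1 ≤ M ∧ Metric.ball z (4 * s) ⊆ V ∧
      (∀ x ∈ Metric.ball z (4 * s), ‖f x‖ ≤ M) ∧ ∀ x ∈ Metric.ball z (4 * s), L x ≤ M := by
    have hfc : ContinuousAt (fun x => ‖f x‖) z :=
      ((hf.continuousOn z hzV).continuousAt (hVo.mem_nhds hzV)).norm
    have h1 : ∀ᶠ x in 𝓝 z, ‖f x‖ < ‖f z‖ + 1 :=
      hfc.eventually (gt_mem_nhds (by linarith))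
    have h2 : ∀ᶠ x in 𝓝 z, L x < L z + 1 :=
      hL.continuousAt.eventually (gt_mem_nhds (by linarith))
    obtain ⟨ε, hε, h⟩ := Metric.eventually_nhds_iff_ball.1
      (h1.and (h2.and (hVo.eventually_mem hzV)))
    have hε4 : 4 * (ε / 4) = ε := by ring
    refine ⟨ε / 4, max (‖f z‖ + 1) (L z + 1), by positivity, ?_, ?_, ?_, ?_⟩
    · exact le_max_of_le_left (by linarith [norm_nonneg (f z)])
    · rw [hε4]
      exact fun x hx => (h x hx).2.2
    · rw [hε4]
      exact fun x hx => le_max_of_le_left (h x hx).1.le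
    · rw [hε4]
      exact fun x hx => le_max_of_le_right (h x hx).2.1.le
  obtain ⟨y, ⟨t, ht, C, δ, hδ, hy⟩, hyz⟩ := Metric.mem_closure_iff.1 hz s hs
  rw [dist_comm] at hyz
  -- As ‖x - y‖ < 2s, the inner circle stays in the ball of radius t about y; the outer one, of
  -- radius 5/4, stays within 3s of y and hence in V.
  set r : ℝ := min (1 / 2) (t / (2 * s)) with hr
  have hr0 : 0 < r := lt_min (by norm_num) (by positivity)
  have hr1 : r < 1 := (min_le_left _ _).trans_lt (by norm_num)
  have hrt : r * (2 * s) ≤ t := by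
    rw [← le_div_iff₀ (by positivity)]
    exact min_le_right _ _
  set θ : ℝ := (0 - Real.log r) / (Real.log (5 / 4) - Real.log r) with hθ
  have hlr : Real.log r < 0 := Real.log_neg hr0 hr1
  have hl54 : 0 < Real.log (5 / 4) := Real.log_pos (by norm_num)
  have hθ1 : θ < 1 := by
    rw [hθ, div_lt_one (by linarith)]
    linarith
  have hMM : 0 < M * (M + 1) := by positivity
  -- The first constant serves the denominator; the second and the new δ come from interpolation
  -- with weights 1 - θ and θ.
  refine ⟨s, hs, max (C + Real.log 3) ((1 - θ) * C + θ * Real.log (M * (M + 1))), (1 - θ) * δ,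
    by nlinarith, fun j x hx => ?_⟩
  have hxy : ‖x - y‖ < 2 * s := by
    rw [← dist_eq_norm]
    rw [Metric.mem_ball] at hx
    linarith [dist_triangle x z y, dist_comm y z]
  have hball : ∀ w : EuclideanSpace ℂ (Fin N), ‖w‖ < 3 * s → y + w ∈ Metric.ball z (4 * s) := by
    intro w hw
    rw [Metric.mem_ball]
    have : dist (y + w) y = ‖w‖ := by simp [dist_eq_norm]
    linarith [dist_triangle (y + w) y z]
  constructor
  · have h1 := (norm_eval_bounds_of_ne_zero (hq j) (c := y) (ρ := 3 * s) (by positivity)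
      (fun w hw => hq0 j w (hsV (by
        have := hball (w - y) (by rwa [← mem_ball_iff_norm])
        simpa using this))) x).2 (by linarith)
    refine le_trans ?_ h1
    have h2 : (1 / 3 : ℝ) ≤ 1 - ‖x - y‖ / (3 * s) := by
      have : ‖x - y‖ / (3 * s) ≤ 2 / 3 := by
        rw [div_le_iff₀ (by positivity)]
        linarith
      linarith
    calc Real.exp (-(n j * max (C + Real.log 3) ((1 - θ) * C + θ * Real.log (M * (M + 1)))))
        ≤ Real.exp (-(n j * (C + Real.log 3))) := by
          gcongr
          exact le_max_left _ _
      _ = Real.exp (-(n j * C)) * (1 / 3) ^ n j := by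
          rw [mul_add, neg_add, Real.exp_add, one_div, ← Real.exp_log (x := (3 : ℝ)⁻¹) (by norm_num),
            ← Real.exp_nat_mul, Real.log_inv]
          simp
      _ ≤ _ := by
          gcongr
          exact (hy j y (Metric.mem_ball_self ht)).1
  · obtain ⟨P, -, hP⟩ := exists_polynomial_eval_add_smul (p j) y (x - y)
    obtain ⟨Q, -, hQ⟩ := exists_polynomial_eval_add_smul (q j) y (x - y)
    have hmem : ∀ ζ : ℂ, ‖ζ‖ ≤ 5 / 4 → y + ζ • (x - y) ∈ Metric.ball z (4 * s) := by
      intro ζ hζ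
      refine hball _ ?_
      rw [norm_smul]
      calc ‖ζ‖ * ‖x - y‖ ≤ 5 / 4 * (2 * s) := by gcongr
        _ < 3 * s := by linarith
    have key := norm_apply_one_le_of_three_circles
      (g := fun ζ => Q.eval ζ * f (y + ζ • (x - y)) - P.eval ζ) (r := r) (R := 5 / 4)
      (a := Real.exp (n j * (C - δ * m j))) (b := Real.exp (n j * Real.log (M * (M + 1))))
      hr0 hr1 (by norm_num) ?_ ?_ ?_
    · simp only [hP, hQ, one_smul, add_sub_cancel] at key
      rw [← hθ, ← Real.exp_mul, ← Real.exp_mul, ← Real.exp_add] at key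
      refine key.trans (Real.exp_le_exp.2 ?_)
      calc _ = n j * (((1 - θ) * C + θ * Real.log (M * (M + 1))) - (1 - θ) * δ * m j) := by ring
        _ ≤ _ := by
          gcongr
          exact le_max_right _ _
    · refine (Q.differentiable.differentiableOn.mul ?_).sub P.differentiable.differentiableOn
      refine hf.comp (by fun_prop) fun ζ hζ => hsV (hmem ζ ?_)
      rwa [mem_closedBall_zero_iff] at hζ
    · intro ζ hζ
      simp only [hP, hQ]
      refine (hy j _ ?_).2
      rw [mem_ball_iff_norm, add_sub_cancel_left, norm_smul, hζ]
      exact (mul_lt_mul_of_pos_left hxy hr0).trans_le hrt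
    · intro ζ hζ
      have hw := hmem ζ hζ.le
      simp only [hP, hQ]
      generalize y + ζ • (x - y) = w at hw
      have hLn : L w ^ n j ≤ M ^ n j := pow_le_pow_left₀ (hL0 w) (hLM w hw) _
      calc _ ≤ ‖MvPolynomial.eval (fun i => w i) (q j)‖ * ‖f w‖ +
            ‖MvPolynomial.eval (fun i => w i) (p j)‖ := by
            rw [← norm_mul]
            exact norm_sub_le _ _
        _ ≤ M ^ n j * M + M ^ n j := by
            gcongr
            · exact (hqL j w).trans hLn
            · exact hfM w hw
            · exact (hpL j w).trans hLn
        _ = M ^ n j * (M + 1) := by ring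
        _ ≤ M ^ n j * (M + 1) ^ n j := by
            gcongr
            exact le_self_pow₀ (by linarith) (by have := hn j; omega)
        _ = _ := by rw [← mul_pow, Real.exp_nat_mul, Real.exp_log hMM]

/-- The set of good points is open and relatively closed in V. -/
lemma approximatesNear_of_isPreconnected {L : EuclideanSpace ℂ (Fin N) → ℝ} (hVo : IsOpen V)
    (hVc : IsPreconnected V)
    (hf : DifferentiableOn ℂ f V) (hL : Continuous L) (hn : ∀ j, 1 ≤ n j)
    (hq : ∀ j, (q j).totalDegree ≤ n j)
    (hq0 : ∀ j, ∀ z ∈ V, MvPolynomial.eval (fun i => z i) (q j) ≠ 0)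
    (hpL : ∀ j x, ‖MvPolynomial.eval (fun i => x i) (p j)‖ ≤ L x ^ n j)
    (hqL : ∀ j x, ‖MvPolynomial.eval (fun i => x i) (q j)‖ ≤ L x ^ n j) (hL0 : ∀ x, 0 ≤ L x)
    {c : EuclideanSpace ℂ (Fin N)} (hcV : c ∈ V) (hc : ApproximatesNear f p q n m c)
    {z : EuclideanSpace ℂ (Fin N)} (hz : z ∈ V) : ApproximatesNear f p q n m z :=
  hVc.subset_of_closure_inter_subset (isOpen_setOf_approximatesNear f p q n m) ⟨c, hcV, hc⟩
    (fun _ hx => approximatesNear_of_mem_closure hVo hf hL hn hq hq0 hpL hqL hL0 hx.2 hx.1) hz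

end

/-! ### Choice of the approximants. -/

lemma continuous_mvPolynomial_eval (p : MvPolynomial (Fin N) ℂ) :
    Continuous fun x : EuclideanSpace ℂ (Fin N) => MvPolynomial.eval (fun i => x i) p :=
  (MvPolynomial.continuous_eval p).comp (by fun_prop)

lemma norm_sub_le_supNormOn {V : Set (EuclideanSpace ℂ (Fin N))}
    {f r : EuclideanSpace ℂ (Fin N) → ℂ} (hf : DifferentiableOn ℂ f V) {d : ℕ}
    (hr : IsRationalOn d r V) {c : EuclideanSpace ℂ (Fin N)} {ρ : ℝ}
    (hB : Metric.closedBall c ρ ⊆ V) {x : EuclideanSpace ℂ (Fin N)}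
    (hx : x ∈ Metric.closedBall c ρ) :
    ‖f x - r x‖ ≤ supNormOn (fun z => f z - r z) (Metric.closedBall c ρ) := by
  obtain ⟨p, q, -, -, h⟩ := hr
  have hrc : ContinuousOn r V :=
    ((continuous_mvPolynomial_eval p).continuousOn.div
      (continuous_mvPolynomial_eval q).continuousOn fun z hz => (h z hz).1).congr
      fun z hz => (h z hz).2
  have hbdd : BddAbove ((fun z => ‖f z - r z‖) '' Metric.closedBall c ρ) :=
    ((isCompact_closedBall c ρ).image_of_continuousOn
      ((hf.continuousOn.sub hrc).mono hB).norm).bddAbove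
  rw [Set.image_eq_range] at hbdd
  exact le_ciSup hbdd ⟨x, hx⟩

/-- A subsequence of very good rational approximants, with denominators normalized at `c`. -/
lemma exists_approximants {V : Set (EuclideanSpace ℂ (Fin N))}
    {f : EuclideanSpace ℂ (Fin N) → ℂ} (hf : DifferentiableOn ℂ f V)
    {c : EuclideanSpace ℂ (Fin N)} {ρ : ℝ} (hρ : 0 < ρ) (hB : Metric.closedBall c ρ ⊆ V)
    {r : ℕ → EuclideanSpace ℂ (Fin N) → ℂ} (hr : ∀ n : ℕ, 1 ≤ n → IsRationalOn n (r n) V)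
    (hlim : Tendsto (fun n : ℕ =>
      supNormOn (fun z => f z - r n z) (Metric.closedBall c ρ) ^ (1 / (n : ℝ))) atTop (𝓝 0))
    {m : ℝ} :
    ∃ (p q : MvPolynomial (Fin N) ℂ) (n : ℕ), 1 ≤ n ∧ p.totalDegree ≤ n ∧ q.totalDegree ≤ n ∧
      (∀ z ∈ V, MvPolynomial.eval (fun i => z i) q ≠ 0) ∧
      MvPolynomial.eval (fun i => c i) q = 1 ∧
      ∀ x ∈ Metric.closedBall c ρ,
        ‖MvPolynomial.eval (fun i => x i) q * f x - MvPolynomial.eval (fun i => x i) p‖ ≤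
          ‖MvPolynomial.eval (fun i => x i) q‖ * Real.exp (-(n * m)) := by
  obtain ⟨n, hn, hn1⟩ := ((hlim.eventually (gt_mem_nhds (Real.exp_pos (-m)))).and
    (eventually_ge_atTop 1)).exists
  obtain ⟨p, q, hp, hq, h⟩ := hr n hn1
  have hcV : c ∈ V := hB (Metric.mem_closedBall_self hρ.le)
  have hqc := (h c hcV).1
  refine ⟨(MvPolynomial.eval (fun i => c i) q)⁻¹ • p, (MvPolynomial.eval (fun i => c i) q)⁻¹ • q, n,
    hn1, (MvPolynomial.totalDegree_smul_le _ _).trans hp,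
    (MvPolynomial.totalDegree_smul_le _ _).trans hq, fun z hz => ?_, ?_, fun x hx => ?_⟩
  · rw [MvPolynomial.smul_eval]
    exact mul_ne_zero (inv_ne_zero hqc) (h z hz).1
  · rw [MvPolynomial.smul_eval, inv_mul_cancel₀ hqc]
  · have h0 := norm_sub_le_supNormOn hf (hr n hn1) hB hx
    have h1 : ‖f x - r n x‖ ≤ Real.exp (-(n * m)) := by
      set S := supNormOn (fun z => f z - r n z) (Metric.closedBall c ρ)
      have hS : 0 ≤ S := (norm_nonneg _).trans h0
      refine h0.trans ?_
      calc S = (S ^ (1 / (n : ℝ))) ^ n := by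
            rw [one_div, Real.rpow_inv_natCast_pow hS (by omega)]
        _ ≤ Real.exp (-m) ^ n := pow_le_pow_left₀ (by positivity) hn.le _
        _ = _ := by
            rw [← Real.exp_nat_mul]
            ring_nf
    obtain ⟨hqx, hrx⟩ := h x (hB hx)
    rw [hrx] at h1
    simp only [MvPolynomial.smul_eval]
    generalize MvPolynomial.eval (fun i => x i) q = Q at *
    generalize MvPolynomial.eval (fun i => x i) p = P at *
    generalize (MvPolynomial.eval (fun i => c i) q)⁻¹ = a at *
    have : a * Q * f x - a * P = a * Q * (f x - P / Q) := by field_simp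
    rw [this, norm_mul]
    gcongr

lemma exists_forall_sub_mul_four_pow_le (C D : ℝ) {δ : ℝ} (hδ : 0 < δ) :
    ∃ J₀ : ℕ, ∀ j, J₀ ≤ j → C - δ * 4 ^ j ≤ -2 ^ j - D := by
  have h := (tendsto_pow_atTop_atTop_of_one_lt (r := (2 : ℝ)) (by norm_num)).eventually_ge_atTop
    ((1 + |C| + |D|) / δ)
  obtain ⟨J₀, hJ⟩ := eventually_atTop.1 h
  refine ⟨J₀, fun j hj => ?_⟩
  have h1 := hJ j hj
  rw [div_le_iff₀ hδ] at h1
  have h2 : (1 : ℝ) ≤ 2 ^ j := one_le_pow₀ (by norm_num)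
  have h3 : (4 : ℝ) ^ j = 2 ^ j * 2 ^ j := by rw [← mul_pow]; norm_num
  rw [h3]
  have h4 : (1 + |C| + |D|) * 2 ^ j ≤ (2 ^ j * δ) * 2 ^ j := by gcongr
  have h5 : |C| + |D| ≤ (|C| + |D|) * 2 ^ j := le_mul_of_one_le_right (by positivity) h2
  have := le_abs_self C
  have := le_abs_self D
  linarith

/-! ### Truncated logarithms. -/

/-- The truncated logarithm `n⁻¹ log (max |q(z) w - p(z)| e⁻ⁿᵗ)`. -/
noncomputable def truncatedLog (p q : MvPolynomial (Fin N) ℂ) (n : ℕ) (t : ℝ)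
    (x : EuclideanSpace ℂ (Fin N) × ℂ) : ℝ :=
  (n : ℝ)⁻¹ * Real.log (max ‖MvPolynomial.eval (fun i => x.1 i) q * x.2 -
    MvPolynomial.eval (fun i => x.1 i) p‖ (Real.exp (-(n * t))))

lemma continuous_truncatedLog (p q : MvPolynomial (Fin N) ℂ) (n : ℕ) (t : ℝ) :
    Continuous (truncatedLog p q n t) := by
  refine continuous_const.mul (Continuous.log ?_ fun x =>
    (lt_max_of_lt_right (Real.exp_pos _)).ne')
  refine Continuous.max (Continuous.norm ?_) continuous_const
  exact (((continuous_mvPolynomial_eval q).comp continuous_fst).mul continuous_snd).sub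
    ((continuous_mvPolynomial_eval p).comp continuous_fst)

/-- Along a complex line, q(z) w - p(z) is a polynomial in one variable. -/
lemma truncatedLog_le_integral (p q : MvPolynomial (Fin N) ℂ) (n : ℕ) (t : ℝ)
    (a b : EuclideanSpace ℂ (Fin N) × ℂ) :
    truncatedLog p q n t a ≤ (2 * Real.pi)⁻¹ * ∫ θ in (0)..(2 * Real.pi),
      truncatedLog p q n t (a + Complex.exp ((θ : ℝ) * Complex.I) • b) := by
  obtain ⟨P, -, hP⟩ := exists_polynomial_eval_add_smul p a.1 b.1
  obtain ⟨Q, -, hQ⟩ := exists_polynomial_eval_add_smul q a.1 b.1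
  have h := log_max_le_integral_log_max
    (Q * (Polynomial.C a.2 + Polynomial.X * Polynomial.C b.2) - P) (Real.exp_pos (-(n * t)))
  have h' := mul_le_mul_of_nonneg_left h (inv_nonneg.2 (Nat.cast_nonneg (α := ℝ) n))
  rw [mul_left_comm, ← intervalIntegral.integral_const_mul] at h'
  simpa [truncatedLog, hP, hQ, mul_comm b.2] using h'

lemma truncatedLog_eq {p q : MvPolynomial (Fin N) ℂ} {n : ℕ} (hn : 1 ≤ n) {t : ℝ}
    {x : EuclideanSpace ℂ (Fin N) × ℂ}
    (hx : ‖MvPolynomial.eval (fun i => x.1 i) q * x.2 - MvPolynomial.eval (fun i => x.1 i) p‖ ≤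
      Real.exp (-(n * t))) : truncatedLog p q n t x = -t := by
  have : (n : ℝ) ≠ 0 := by positivity
  rw [truncatedLog, max_eq_right hx, Real.log_exp]
  field_simp

lemma truncatedLog_le {p q : MvPolynomial (Fin N) ℂ} {n : ℕ} (hn : 1 ≤ n) {t : ℝ} (ht : 0 ≤ t)
    {x : EuclideanSpace ℂ (Fin N) × ℂ} {A : ℝ} (hA : 1 ≤ A)
    (hp : ‖MvPolynomial.eval (fun i => x.1 i) p‖ ≤ A ^ n)
    (hq : ‖MvPolynomial.eval (fun i => x.1 i) q‖ ≤ A ^ n) :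
    truncatedLog p q n t x ≤ Real.log (A * (1 + ‖x.2‖)) := by
  have hn0 : (0 : ℝ) < n := by positivity
  have h1 : 1 ≤ 1 + ‖x.2‖ := by linarith [norm_nonneg x.2]
  rw [truncatedLog, inv_mul_le_iff₀ hn0, ← Real.log_pow]
  refine Real.log_le_log (lt_max_of_lt_right (Real.exp_pos _)) (max_le ?_ ?_)
  · calc _ ≤ ‖MvPolynomial.eval (fun i => x.1 i) q‖ * ‖x.2‖ +
          ‖MvPolynomial.eval (fun i => x.1 i) p‖ := by
          rw [← norm_mul]
          exact norm_sub_le _ _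
      _ ≤ A ^ n * ‖x.2‖ + A ^ n := by gcongr
      _ = A ^ n * (1 + ‖x.2‖) := by ring
      _ ≤ A ^ n * (1 + ‖x.2‖) ^ n := by
          gcongr
          exact le_self_pow₀ h1 (by omega)
      _ = _ := (mul_pow _ _ _).symm
  · calc Real.exp (-(n * t)) ≤ 1 := Real.exp_le_one_iff.2 (by simpa using by positivity)
      _ ≤ _ := one_le_pow₀ (one_le_mul_of_one_le_of_one_le hA h1)

/-- In q w - p = q (w - y) + (q y - p) the first term is at least 2η e^{-nC} and the second at most
half of that. -/
lemma neg_le_truncatedLog {p q : MvPolynomial (Fin N) ℂ} {n : ℕ} (hn : 1 ≤ n) {t C η ε : ℝ}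
    {x : EuclideanSpace ℂ (Fin N) × ℂ} {y : ℂ} (hη : 0 < η) (hy : 2 * η ≤ ‖x.2 - y‖)
    (hq : Real.exp (-(n * C)) ≤ ‖MvPolynomial.eval (fun i => x.1 i) q‖)
    (hqp : ‖MvPolynomial.eval (fun i => x.1 i) q * y - MvPolynomial.eval (fun i => x.1 i) p‖ ≤
      Real.exp (n * ε)) (hε : ε ≤ -(C + |Real.log η|)) :
    -(C + |Real.log η|) ≤ truncatedLog p q n t x := by
  have hn0 : (0 : ℝ) < n := by positivity
  have hn1 : (1 : ℝ) ≤ n := by exact_mod_cast hn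
  have hlog : -(n * |Real.log η|) ≤ Real.log η := by
    have h1 := neg_abs_le (Real.log η)
    have h2 : |Real.log η| ≤ n * |Real.log η| := le_mul_of_one_le_left (abs_nonneg _) hn1
    linarith
  have hexp : Real.exp (n * ε) ≤ Real.exp (-(n * C)) * η := by
    calc _ ≤ Real.exp (-(n * C) + Real.log η) := by
          gcongr
          nlinarith
      _ = _ := by rw [Real.exp_add, Real.exp_log hη]
  have hlow : Real.exp (-(n * C)) * η ≤ ‖MvPolynomial.eval (fun i => x.1 i) q * x.2 -
      MvPolynomial.eval (fun i => x.1 i) p‖ := by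
    generalize MvPolynomial.eval (fun i => x.1 i) q = Q at *
    generalize MvPolynomial.eval (fun i => x.1 i) p = P at *
    have h1 : Q * x.2 - P = Q * (x.2 - y) - -(Q * y - P) := by ring
    have h2 := norm_sub_norm_le (Q * (x.2 - y)) (-(Q * y - P))
    rw [← h1, norm_mul, norm_neg] at h2
    have h3 : Real.exp (-(n * C)) * (2 * η) ≤ ‖Q‖ * ‖x.2 - y‖ := by gcongr
    linarith
  rw [truncatedLog, le_inv_mul_iff₀ hn0]
  calc n * -(C + |Real.log η|) ≤ -(n * C) + Real.log η := by linarith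
    _ = Real.log (Real.exp (-(n * C)) * η) := by
        rw [Real.log_mul (Real.exp_pos _).ne' hη.ne', Real.log_exp]
    _ ≤ _ := Real.log_le_log (by positivity) (le_max_of_le_left hlow)

/-! ### Construction of the plurisubharmonic function. -/

theorem exists_isPlurisubharmonicOn_eq_bot_iff_mem_graphOver
    {V : Set (EuclideanSpace ℂ (Fin N))} (hVo : IsOpen V) (hVc : IsConnected V)
    {f : EuclideanSpace ℂ (Fin N) → ℂ} (hf : DifferentiableOn ℂ f V)
    {c : EuclideanSpace ℂ (Fin N)} {ρ : ℝ} (hρ : 0 < ρ) (hB : Metric.closedBall c ρ ⊆ V)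
    {r : ℕ → EuclideanSpace ℂ (Fin N) → ℂ} (hr : ∀ n : ℕ, 1 ≤ n → IsRationalOn n (r n) V)
    (hlim : Tendsto (fun n : ℕ =>
      supNormOn (fun z => f z - r n z) (Metric.closedBall c ρ) ^ (1 / (n : ℝ))) atTop (𝓝 0)) :
    ∃ v : EuclideanSpace ℂ (Fin N) × ℂ → EReal, IsPlurisubharmonicOn v Set.univ ∧
      {x | v x = ⊥} ∩ (V ×ˢ (Set.univ : Set ℂ)) = graphOver f V := by
  have hcV : c ∈ V := hB (Metric.mem_closedBall_self hρ.le)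
  choose p q n hn hp hq hq0 hqc happ using fun j : ℕ =>
    exists_approximants hf hρ hB hr hlim (m := (4 : ℝ) ^ j)
  obtain ⟨F, hF⟩ := ((isCompact_closedBall c ρ).image_of_continuousOn
    (hf.continuousOn.mono hB).norm).bddAbove
  have hF' : ∀ x ∈ Metric.closedBall c ρ, ‖f x‖ ≤ F := fun x hx => hF ⟨x, hx, rfl⟩
  have hF0 : 0 ≤ F := (norm_nonneg _).trans (hF' c (Metric.mem_closedBall_self hρ.le))
  -- On the ball |q_j| ≤ 2^{n_j} and |p_j| ≤ 2^{n_j} (F + 1); the last factor is the Bernstein–Walsh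
  -- growth.
  set L : EuclideanSpace ℂ (Fin N) → ℝ := fun x => 2 * (F + 1) * (1 + ‖x - c‖ / ρ) with hL
  have hL1 : ∀ x, 1 ≤ L x := fun x => by
    have : 0 ≤ ‖x - c‖ / ρ := by positivity
    exact one_le_mul_of_one_le_of_one_le (by linarith) (by linarith)
  have hLc : Continuous L := by fun_prop
  have hqb := fun j => norm_eval_bounds_of_ne_zero (hq j) hρ
    fun x hx => hq0 j x (hB (Metric.ball_subset_closedBall hx))
  have hqL : ∀ j x, ‖MvPolynomial.eval (fun i => x i) (q j)‖ ≤ L x ^ n j := by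
    intro j x
    have h := (hqb j x).1
    rw [hqc, norm_one, one_mul] at h
    refine h.trans (pow_le_pow_left₀ (by positivity) ?_ _)
    exact le_mul_of_one_le_left (by positivity) (by linarith)
  have hpL : ∀ j x, ‖MvPolynomial.eval (fun i => x i) (p j)‖ ≤ L x ^ n j := by
    intro j x
    rw [hL, mul_pow]
    refine norm_eval_le_of_forall_mem_closedBall (hp j) hρ (fun y hy => ?_) x
    have h1 := happ j y hy
    have h2 : ‖MvPolynomial.eval (fun i => y i) (q j)‖ ≤ 2 ^ n j := by
      have h := (hqb j y).1
      rw [hqc, norm_one, one_mul] at h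
      refine h.trans (pow_le_pow_left₀ (by positivity) ?_ _)
      have : ‖y - c‖ / ρ ≤ 1 := (div_le_one hρ).2 (mem_closedBall_iff_norm.1 hy)
      linarith
    have h3 : Real.exp (-(n j * 4 ^ j)) ≤ 1 := Real.exp_le_one_iff.2 (by simp)
    calc _ = ‖MvPolynomial.eval (fun i => y i) (q j) * f y -
          (MvPolynomial.eval (fun i => y i) (q j) * f y -
            MvPolynomial.eval (fun i => y i) (p j))‖ := by rw [sub_sub_cancel]
      _ ≤ ‖MvPolynomial.eval (fun i => y i) (q j)‖ * ‖f y‖ +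
          ‖MvPolynomial.eval (fun i => y i) (q j)‖ * Real.exp (-(n j * 4 ^ j)) := by
          refine (norm_sub_le _ _).trans ?_
          rw [norm_mul]
          gcongr
      _ ≤ 2 ^ n j * F + 2 ^ n j * 1 := by
          gcongr
          exact hF' y hy
      _ = 2 ^ n j * (F + 1) := by ring
      _ ≤ 2 ^ n j * (F + 1) ^ n j := by
          gcongr
          exact le_self_pow₀ (by linarith) (by have := hn j; omega)
      _ = _ := (mul_pow _ _ _).symm
  have hnear : ∀ z ∈ V, ApproximatesNear f p q n (fun j => 4 ^ j) z := by
    intro z hz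
    refine approximatesNear_of_isPreconnected hVo hVc.isPreconnected hf hLc hn hq hq0 hpL hqL
      (fun x => zero_le_one.trans (hL1 x)) hcV ?_ hz
    -- On the half ball |q_j| ≥ (1 - 1/2)^{n_j}, whence C = log 2; the chosen error rate gives δ =
    -- 1.
    refine ⟨ρ / 2, by positivity, Real.log 2, 1, one_pos, fun j x hx => ?_⟩
    rw [mem_ball_iff_norm] at hx
    have hxρ : ‖x - c‖ / ρ ≤ 1 / 2 := by
      rw [div_le_iff₀ hρ]
      linarith
    have h1 := (hqb j x).1
    have h2 := (hqb j x).2 (by linarith)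
    rw [hqc, norm_one, one_mul] at h1 h2
    constructor
    · refine le_trans ?_ h2
      calc _ = (1 / 2 : ℝ) ^ n j := by
            rw [Real.exp_neg, Real.exp_nat_mul, Real.exp_log (by norm_num), one_div, inv_pow]
        _ ≤ _ := pow_le_pow_left₀ (by norm_num) (by linarith) _
    · refine (happ j x (by rw [mem_closedBall_iff_norm]; linarith)).trans ?_
      calc _ ≤ (2 : ℝ) ^ n j * Real.exp (-(n j * 4 ^ j)) := by
            gcongr
            exact h1.trans (pow_le_pow_left₀ (by positivity) (by linarith) _)
        _ = _ := by
            rw [mul_sub, Real.exp_sub, Real.exp_nat_mul, Real.exp_log (by norm_num), Real.exp_neg,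
              one_mul]
            rfl
  set T : ℕ → EuclideanSpace ℂ (Fin N) × ℂ → ℝ := fun j x =>
    (1 / 2 : ℝ) ^ j * truncatedLog (p j) (q j) (n j) (2 ^ j) x with hT
  set G : EuclideanSpace ℂ (Fin N) × ℂ → ℝ := fun x => Real.log (L x.1 * (1 + ‖x.2‖)) with hG
  have hbase : ∀ x : EuclideanSpace ℂ (Fin N) × ℂ, 1 ≤ L x.1 * (1 + ‖x.2‖) := fun x =>
    one_le_mul_of_one_le_of_one_le (hL1 _) (by linarith [norm_nonneg x.2])
  have hGc : Continuous G := Continuous.log (by fun_prop) fun x => (by linarith [hbase x])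
  have hfin : ∀ z ∈ V, ∀ w, w ≠ f z → dominatedSum T G (z, w) ≠ ⊥ := by
    intro z hz w hw
    obtain ⟨s, hs, C, δ, hδ, h⟩ := hnear z hz
    set η := ‖w - f z‖ / 2 with hη
    have hη0 : 0 < η := half_pos (norm_pos_iff.2 (sub_ne_zero.2 hw))
    obtain ⟨J₀, hJ⟩ := exists_forall_sub_mul_four_pow_le C (C + |Real.log η|) hδ
    refine dominatedSum_ne_bot (C := C + |Real.log η|) (J₀ := J₀) (Real.log_nonneg (hbase _))
      fun j hj => ?_
    obtain ⟨h1, h2⟩ := h j z (Metric.mem_ball_self hs)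
    have h3 : (0 : ℝ) < 2 ^ j := by positivity
    rw [← mul_neg]
    refine mul_le_mul_of_nonneg_left ?_ (by positivity)
    exact neg_le_truncatedLog (x := (z, w)) (hn j) hη0 (by simp [hη]; linarith) h1 h2 (by
      linarith [hJ j hj])
  refine ⟨dominatedSum T G, isPlurisubharmonicOn_dominatedSum
    (fun j => continuous_const.mul (continuous_truncatedLog _ _ _ _)) hGc (fun j x => ?_)
    (fun j a b => ?_) ⟨(c, f c + 1), hfin c hcV _ (by simp)⟩, ?_⟩
  · exact mul_le_mul_of_nonneg_left
      (truncatedLog_le (hn j) (by positivity) (hL1 _) (hpL j _) (hqL j _)) (by positivity)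
  · simp only [hT]
    rw [intervalIntegral.integral_const_mul, mul_left_comm]
    exact mul_le_mul_of_nonneg_left (truncatedLog_le_integral _ _ _ _ a b) (by positivity)
  · ext ⟨z, w⟩
    simp only [Set.mem_inter_iff, Set.mem_ofPred_eq, Set.mem_prod, Set.mem_univ, and_true,
      graphOver]
    constructor
    · rintro ⟨hbot, hz⟩
      refine ⟨hz, ?_⟩
      by_contra hw
      exact hfin z hz w hw hbot
    · rintro ⟨hz, rfl⟩
      refine ⟨?_, hz⟩
      obtain ⟨s, hs, C, δ, hδ, h⟩ := hnear z hz
      obtain ⟨J₀, hJ⟩ := exists_forall_sub_mul_four_pow_le C 0 hδ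
      refine dominatedSum_eq_bot (J₀ := J₀) fun j hj => le_of_eq ?_
      have hle : Real.exp (n j * (C - δ * 4 ^ j)) ≤ Real.exp (-(n j * 2 ^ j)) := by
        rw [← mul_neg]
        gcongr
        linarith [hJ j hj]
      simp only [hT]
      -- The weight 2⁻ʲ cancels the truncation level 2ʲ, leaving the term -1.
      rw [truncatedLog_eq (x := (z, f z)) (hn j)
        ((h j z (Metric.mem_ball_self hs)).2.trans hle), mul_neg, ← mul_pow]
      norm_num

end PluripolarHull

theorem lemma3p4 {N : ℕ} (V : Set (EuclideanSpace ℂ (Fin N)))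
    (hVo : IsOpen V) (hVc : IsConnected V)
    (f : EuclideanSpace ℂ (Fin N) → ℂ) (hf : DifferentiableOn ℂ f V)
    (c : EuclideanSpace ℂ (Fin N)) (ρ : ℝ) (hρ : 0 < ρ) (hB : Metric.closedBall c ρ ⊆ V)
    (r : ℕ → EuclideanSpace ℂ (Fin N) → ℂ)
    (hr : ∀ n : ℕ, 1 ≤ n → PluripolarHull.IsRationalOn n (r n) V)
    (hlim : Tendsto
      (fun n : ℕ => PluripolarHull.supNormOn (fun z => f z - r n z) (Metric.closedBall c ρ) ^
        (1 / (n : ℝ))) atTop (𝓝 0)) :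
    (∃ v : EuclideanSpace ℂ (Fin N) × ℂ → EReal,
      PluripolarHull.IsPlurisubharmonicOn v Set.univ ∧
      {x | v x = ⊥} ∩ (V ×ˢ (Set.univ : Set ℂ)) = PluripolarHull.graphOver f V) ∧
    PluripolarHull.pluripolarHull (PluripolarHull.graphOver f V) Set.univ ∩
      (V ×ˢ (Set.univ : Set ℂ)) = PluripolarHull.graphOver f V := by
  obtain ⟨v, hv, hvΓ⟩ := PluripolarHull.exists_isPlurisubharmonicOn_eq_bot_iff_mem_graphOver
    hVo hVc hf hρ hB hr hlim
  refine ⟨⟨v, hv, hvΓ⟩, Set.Subset.antisymm ?_ ?_⟩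
  · rintro x ⟨⟨-, hx⟩, hxV⟩
    rw [← hvΓ]
    exact ⟨hx v hv fun y hy => (hvΓ.symm.subset hy).1, hxV⟩
  · intro x hx
    exact ⟨⟨Set.mem_univ x, fun h _ hA => hA x hx⟩, hx.1, Set.mem_univ _⟩
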